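/- A canonical Local Friendliness (LF) scenario $S=(I_A,I_F,M,O)$ consists of a finite set $I_A=\{1,\dots,N\}$ of agents, a subset $I_F\subseteq I_A$ (the agents that have a friend), for each agent $i$ a finite set $M_i=\{1,\dots,m_i\}$ of measurement settings, and for each setting $x_i\in M_i$ a finite set $O_{x_i}=\{1,\dots,o_{x_i}\}$ of outcomes, where $N,m_i,o_{x_i}\ge 2$ for all $i$ and $x_i$. A behaviour assigns to each $\vec x\in\prod_i M_i$ a probability distribution $\wp(\cdot|\vec x)$ on $O_{\vec x}=\prod_i O_{x_i}$. The set $\mathcal B(S)$ consists of the behaviours with a local hidden variable (LHV) model, $\wp(\vec a|\vec x)=\int_\Lambda \prod_{i=1}^N P(a_i|x_i,\lambda)\,d\mu(\lambda)$, where $\mu$ is a probability measure on a measurable space $\Lambda$ and, for all $i$, $x_i$ and $\lambda$, $P(\cdot|x_i,\lambda)$ is a probability distribution on $O_{x_i}$, measurable in $\lambda$. The set $\mathcal{LF}(S)$ consists of the behaviours of the form $$\wp(\vec a|\vec x)=\sum_{\vec c}\ \prod_{i\in F_{\vec x}}\delta_{a_i,c_i}\cdot P^{\mathcal{LA}}(\vec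 a_{J_{\vec x}}|\vec x_{J_{\vec x}},\vec c)\cdot P(\vec c),\qquad F_{\vec x}=\{i\in I_F: x_i=1\},\quad J_{\vec x}=I_A\setminus F_{\vec x},$$ where $P$ is a probability distribution of strings $\vec c\in\prod_{i\in I_F}O_{x_i=1}$ and, for each $\vec c$, the $P^{\mathcal{LA}}(\vec a_{J_{\vec x}}|\vec x_{J_{\vec x}},\vec c)$ are marginals of a behaviour $P^{\mathcal{LA}}(\vec a|\vec x,\vec c)$ that satisfies local agency: for every $V\subseteq I_A$ the marginal distribution of $\vec a_V$ depends on $\vec x$ only through $\vec x_V$. **Theorem.** Let $S$ be a canonical LF scenario. Then $\mathcal{LF}(S)=\mathcal B(S)$ if and only if at least one of the following holds: 1. $|I_F|=|I_A|-1$ and $|M_j|=2$ for all $j\in I_F$; 2. $I_F=I_A$ and $|M_i|=2$ for at least $|I_A|-1$ agents $i$. Moreover, if neither holds, then there is a behaviour $\wp\in\mathcal{LF}(S)$ that has no LHV model and in which two agents share a Popescu–Rohrlich box: there are agents $s\ne t$, distinct settings $y_0,y_1\in M_s$ and distinct settings $z_0,z_1\in M_t$ such that for all $k,l,u,v\in\{0,1\}$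 and every $\vec x$ with $x_s=y_k$ and $x_t=z_l$, the probability that $a_s=1+u$ and $a_t=1+v$ under $\wp(\cdot|\vec x)$ equals $\tfrac12$ if $u+v\equiv kl \pmod 2$, and $0$ otherwise. -/

import Mathlib

open MeasureTheory

/-- A canonical Local Friendliness scenario `S = (I_A, I_F, M, O)`.
The agents (superobservers) are `I_A = Fin numAgents`, the measurement settings of agent `i` are
`M_i = Fin (numSettings i)`, the outcomes of setting `x` of agent `i` are
`O_{x} = Fin (numOutcomes i x)`, and `friends` is the set `I_F ⊆ I_A` of the agents that have a
friend. All the parameter sets have at least two elements. (Labels start from `0`, not `1`.) -/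
structure LFScenario where
  numAgents : ℕ
  numSettings : Fin numAgents → ℕ
  numOutcomes : (i : Fin numAgents) → Fin (numSettings i) → ℕ
  friends : Finset (Fin numAgents)
  two_le_numAgents : 2 ≤ numAgents
  two_le_numSettings : ∀ i, 2 ≤ numSettings i
  two_le_numOutcomes : ∀ i x, 2 ≤ numOutcomes i x

namespace LFScenario

/-- The set `I_A` of agents. -/
abbrev Agent (S : LFScenario) : Type := Fin S.numAgents

/-- The set `M_i` of measurement settings of agent `i`. -/
abbrev Setting (S : LFScenario) (i : S.Agent) : Type := Fin (S.numSettings i)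

/-- The set of outcomes of the measurement `x` of agent `i`. -/
abbrev Outcome (S : LFScenario) (i : S.Agent) (x : S.Setting i) : Type :=
  Fin (S.numOutcomes i x)

/-- Strings of inputs `x ∈ M = ∏ i, M_i`. -/
abbrev Inputs (S : LFScenario) : Type := (i : S.Agent) → S.Setting i

/-- Strings of outcomes `a ∈ O_x = ∏ i, O_{x_i}` in the measurement context `x`. -/
abbrev Outputs (S : LFScenario) (x : S.Inputs) : Type := (i : S.Agent) → S.Outcome i (x i)

/-- The query measurement of agent `i`: its first setting. -/
def query (S : LFScenario) (i : S.Agent) : S.Setting i :=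
  ⟨0, lt_of_lt_of_le Nat.zero_lt_two (S.two_le_numSettings i)⟩

/-- A behaviour: for each input string `x` a probability distribution `p (a | x)` on the
outcome strings `a` of that context. -/
structure Behaviour (S : LFScenario) where
  prob : (x : S.Inputs) → S.Outputs x → ℝ
  prob_nonneg : ∀ x a, 0 ≤ prob x a
  sum_prob : ∀ x, ∑ a : S.Outputs x, prob x a = 1

/-- The marginal `p (a_J | x)`: the sum of `p (b | x)` over all the strings `b` that agree with
`a` on `J`. -/
def Behaviour.marginal {S : LFScenario} (p : S.Behaviour) (J : Finset S.Agent)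
    (x : S.Inputs) (a : S.Outputs x) : ℝ :=
  ∑ b : S.Outputs x, if ∀ i ∈ J, b i = a i then p.prob x b else 0

/-- Local agency, `p (a_V | x) = p (a_V | x_V)` for every set `V` of agents: if the input strings
`x` and `x'` agree on `V`, then `p (a_V | x) = p (a_V | x')`. (The outcomes of the agents in `V` in
the two contexts are compared through their labels.) -/
def Behaviour.LocalAgency {S : LFScenario} (p : S.Behaviour) : Prop :=
  ∀ (V : Finset S.Agent) (x x' : S.Inputs) (a : S.Outputs x) (a' : S.Outputs x'),
    (∀ i ∈ V, x i = x' i) → (∀ i ∈ V, (a i : ℕ) = (a' i : ℕ)) →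
      p.marginal V x a = p.marginal V x' a'

/-- Strings `c` of outcomes recorded by the friends; the friend of agent `i` has the outcome set
of the query measurement of `i`. -/
abbrev FriendOutcomes (S : LFScenario) : Type :=
  (i : {i : S.Agent // i ∈ S.friends}) → S.Outcome i (S.query i)

/-- `F_x`: the agents with a friend that perform the query measurement in the context `x`. -/
def queried (S : LFScenario) (x : S.Inputs) : Finset S.Agent :=
  S.friends.filter fun i => x i = S.query i

/-- The factor `∏ i ∈ F_x, δ (a_i, c_i)`. -/
def queryDelta (S : LFScenario) (x : S.Inputs) (a : S.Outputs x) (c : S.FriendOutcomes) : ℝ :=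
  ∏ i ∈ S.friends.attach.filter (fun i => x i.1 = S.query i.1),
    if (a i.1 : ℕ) = (c i : ℕ) then 1 else 0

/-- The set `LF(S)` of Local Friendliness behaviours: those of the form
`p (a | x) = ∑ c, (∏ i ∈ F_x, δ (a_i, c_i)) * Q (a_J | x_J, c) * P (c)`, with `J = I_A \ F_x`,
for a probability distribution `P` of the outcomes of the friends and, for each `c`, distributions
`Q (· | ·, c)` that satisfy local agency. -/
def LF (S : LFScenario) : Set S.Behaviour :=
  {p | ∃ (P : S.FriendOutcomes → ℝ) (Q : S.FriendOutcomes → S.Behaviour),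
    (∀ c, 0 ≤ P c) ∧ ∑ c, P c = 1 ∧ (∀ c, (Q c).LocalAgency) ∧
    ∀ x a, p.prob x a =
      ∑ c, S.queryDelta x a c * (Q c).marginal (Finset.univ \ S.queried x) x a * P c}

/-- The set `B(S)` of the behaviours that have a local hidden variable model. -/
def B (S : LFScenario) : Set S.Behaviour :=
  {p | ∃ (Λ : Type) (_ : MeasurableSpace Λ) (μ : Measure Λ)
      (P : (i : S.Agent) → (x : S.Setting i) → S.Outcome i x → Λ → ℝ),
    IsProbabilityMeasure μ ∧
    (∀ i x a, Measurable (P i x a)) ∧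
    (∀ i x a l, 0 ≤ P i x a l) ∧
    (∀ i x l, ∑ a, P i x a l = 1) ∧
    ∀ x a, p.prob x a = ∫ l, ∏ i, P i (x i) (a i) l ∂μ}

/-- The Popescu-Rohrlich box `PR (u, v | k, l)`, with binary inputs `k, l` and outputs `u, v`:
it is `1/2` if `u ⊕ v = k l`, and `0` otherwise. -/
noncomputable def prBox (k l u v : Fin 2) : ℝ := if u + v = k * l then 1 / 2 else 0

/-- Two distinct agents `s` and `t` share a PR box in the behaviour `p`: for two distinct settings
`y 0, y 1` of `s` and two distinct settings `z 0, z 1` of `t`, the marginal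
`p (a_s, a_t | x)` in every context `x` with `x_s = y k` and `x_t = z l` is the PR box
on the first two outcomes of `s` and of `t`. -/
def Behaviour.SharePRBox {S : LFScenario} (p : S.Behaviour) (s t : S.Agent) : Prop :=
  s ≠ t ∧ ∃ (y : Fin 2 → S.Setting s) (z : Fin 2 → S.Setting t), y 0 ≠ y 1 ∧ z 0 ≠ z 1 ∧
    ∀ (k l u v : Fin 2) (x : S.Inputs) (a : S.Outputs x), x s = y k → x t = z l →
      (a s : ℕ) = (u : ℕ) → (a t : ℕ) = (v : ℕ) → p.marginal {s, t} x a = prBox k l u v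

end LFScenario

/-! Both alternatives say the same thing: there is an agent `j` such that every other agent has a
friend and exactly two settings (`exists_agent_iff`).

If such a `j` exists, fix the friends' record `c`. A queried agent with a friend just reveals `c_i`,
so each agent other than `j` has a single setting left, the second one. Local agency makes the joint
law of the outcomes `b` of these settings independent of what `j` measures. Hence `(c, b)` is a
finite hidden variable: the others answer deterministically, and `j` answers a non-revealed setting
from its conditional distribution given `b` (`LF_subset_B`). The inclusion `B_subset_LF` always
holds: given an LHV model, let the friends' records be drawn from the responses to the queries and
condition the hidden variable on them.

If no such `j` exists, there are two agents each having two settings that do not reveal a friend's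
record. They can share a PR box on these settings while every revealing query returns the first
outcome. The record is then constant and imposes no constraint beyond local agency
(`exists_sharePRBox`). A PR box wins the CHSH game with total score 4, against at most 3 for an LHV
model (`Behaviour.SharePRBox.notMem_B`). -/

namespace LFScenario


/-! ### Marginals of product weights on outcome strings -/

section Sums

variable {ι : Type*} [Fintype ι] [DecidableEq ι] {κ : ι → Type*} [∀ i, Fintype (κ i)]

theorem sum_pi_ite_forall_prod (J : Finset ι) (r : ∀ i, κ i → Prop)
    [∀ i, DecidablePred (r i)] (f : ∀ i, κ i → ℝ) (h : ∀ i ∉ J, ∑ k, f i k = 1) :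
    ∑ b : ∀ i, κ i, (if ∀ i ∈ J, r i (b i) then ∏ i, f i (b i) else 0) =
      ∏ i ∈ J, ∑ k, if r i k then f i k else 0 := by
  have h1 : ∀ b : ∀ i, κ i, (if ∀ i ∈ J, r i (b i) then ∏ i, f i (b i) else 0) =
      ∏ i, (if i ∈ J then (if r i (b i) then f i (b i) else 0) else f i (b i)) := by
    intro b
    split_ifs with hb
    · refine Finset.prod_congr rfl fun i _ => ?_
      by_cases hi : i ∈ J
      · simp [hi, hb i hi]
      · simp [hi]
    · push Not at hb
      obtain ⟨i, hi, hr⟩ := hb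
      exact (Finset.prod_eq_zero (Finset.mem_univ i) (by simp [hi, hr])).symm
  rw [Finset.sum_congr rfl fun b _ => h1 b,
    ← Fintype.prod_sum (fun i k => if i ∈ J then (if r i k then f i k else 0) else f i k),
    ← Finset.prod_subset (Finset.subset_univ J)]
  · exact Finset.prod_congr rfl fun i hi => by simp [hi]
  · intro i _ hi
    simp [hi, h i hi]

theorem sum_pi_ite_forall_eq_prod [∀ i, DecidableEq (κ i)] (J : Finset ι) (a : ∀ i, κ i)
    (f : ∀ i, κ i → ℝ) (h : ∀ i, ∑ k, f i k = 1) :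
    ∑ b : ∀ i, κ i, (if ∀ i ∈ J, b i = a i then ∏ i, f i (b i) else 0) =
      ∏ i ∈ J, f i (a i) := by
  rw [sum_pi_ite_forall_prod J (fun i k => k = a i) f fun i _ => h i]
  exact Finset.prod_congr rfl fun i _ => by simp

end Sums

/-! ### Behaviours given by possibly signed local models -/

/-- The first outcome of a measurement. -/
def firstOutcome (S : LFScenario) (i : S.Agent) (x : S.Setting i) : S.Outcome i x :=
  ⟨0, lt_of_lt_of_le Nat.zero_lt_two (S.two_le_numOutcomes i x)⟩

/-- A real number as a label-dependent weight: `1/2 + b` and `1/2 - b` on the first two labels. -/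
noncomputable def bias (b : ℝ) (n : ℕ) : ℝ :=
  if n = 0 then 1 / 2 + b else if n = 1 then 1 / 2 - b else 0

theorem sum_bias {m : ℕ} (hm : 2 ≤ m) (b : ℝ) : ∑ a : Fin m, bias b a = 1 := by
  obtain ⟨m, rfl⟩ := Nat.exists_eq_add_of_le' hm
  rw [Fin.sum_univ_succ, Fin.sum_univ_succ]
  simp [bias]
  norm_num

variable {S : LFScenario}

/-- `p` is represented by the response functions `R` with respect to the density `g` on `(Λ, μ)`.
The response functions and the density may take negative values. -/
def Behaviour.IsModel (p : S.Behaviour) {Λ : Type*} [MeasurableSpace Λ] (μ : Measure Λ)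
    (g : Λ → ℝ) (R : (i : S.Agent) → (x : S.Setting i) → S.Outcome i x → Λ → ℝ) : Prop :=
  (∀ i x l, ∑ a, R i x a l = 1) ∧
  (∀ (x : S.Inputs) (a : S.Outputs x),
    Integrable (fun l => g l * ∏ i, R i (x i) (a i) l) μ) ∧
  ∀ (x : S.Inputs) (a : S.Outputs x), p.prob x a = ∫ l, g l * ∏ i, R i (x i) (a i) l ∂μ

namespace Behaviour.IsModel

variable {p : S.Behaviour} {Λ : Type*} [MeasurableSpace Λ] {μ : Measure Λ}
    {g : Λ → ℝ} {R : (i : S.Agent) → (x : S.Setting i) → S.Outcome i x → Λ → ℝ}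

/-- Normalization of the responses alone sums out the agents outside `J`; no positivity enters, so
this also serves the signed model of the PR box. -/
theorem marginal_eq (h : p.IsModel μ g R) (J : Finset S.Agent) (x : S.Inputs)
    (a : S.Outputs x) : p.marginal J x a = ∫ l, g l * ∏ i ∈ J, R i (x i) (a i) l ∂μ := by
  obtain ⟨hsum, hint, hp⟩ := h
  have h1 : ∀ l, g l * ∏ i ∈ J, R i (x i) (a i) l =
      ∑ b : S.Outputs x, if ∀ i ∈ J, b i = a i then g l * ∏ i, R i (x i) (b i) l else 0 := by
    intro l
    rw [← sum_pi_ite_forall_eq_prod J a (fun i k => R i (x i) k l) fun i => hsum i (x i) l,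
      Finset.mul_sum]
    exact Finset.sum_congr rfl fun b _ => by split_ifs <;> simp
  rw [Behaviour.marginal, integral_congr_ae (Filter.Eventually.of_forall h1), integral_finsetSum]
  · refine Finset.sum_congr rfl fun b _ => ?_
    split_ifs
    · exact hp x b
    · simp
  · intro b _
    split_ifs
    · exact hint x b
    · simp

/-- By `marginal_eq`, only the responses of the agents in `V` enter the marginal on `V`. -/
theorem localAgency (h : p.IsModel μ g R) : p.LocalAgency := by
  intro V x x' a a' hx ha
  rw [h.marginal_eq, h.marginal_eq]
  congr 1
  ext l
  congr 1
  refine Finset.prod_congr rfl fun i hi => ?_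
  have key : ∀ (y y' : S.Setting i) (b : S.Outcome i y) (b' : S.Outcome i y'), y = y' →
      (b : ℕ) = (b' : ℕ) → R i y b l = R i y' b' l := by
    rintro y y' b b' rfl hb
    rw [Fin.ext hb]
  exact key _ _ _ _ (hx i hi) (ha i hi)

end Behaviour.IsModel

/-- The behaviour with a given (possibly signed) model. -/
noncomputable def Behaviour.ofModel {Λ : Type*} [MeasurableSpace Λ] (μ : Measure Λ) (g : Λ → ℝ)
    (R : (i : S.Agent) → (x : S.Setting i) → S.Outcome i x → Λ → ℝ)
    (hsum : ∀ i x l, ∑ a, R i x a l = 1)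
    (hint : ∀ (x : S.Inputs) (a : S.Outputs x),
      Integrable (fun l => g l * ∏ i, R i (x i) (a i) l) μ)
    (hg : ∫ l, g l ∂μ = 1)
    (hnonneg : ∀ (x : S.Inputs) (a : S.Outputs x), 0 ≤ ∫ l, g l * ∏ i, R i (x i) (a i) l ∂μ) :
    S.Behaviour where
  prob x a := ∫ l, g l * ∏ i, R i (x i) (a i) l ∂μ
  prob_nonneg := hnonneg
  sum_prob x := by
    rw [← integral_finsetSum _ fun a _ => hint x a, ← hg]
    congr 1
    ext l
    rw [← Finset.mul_sum, ← Fintype.prod_sum (fun i k => R i (x i) k l)]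
    simp [hsum]

/-! ### LHV models and the CHSH inequality -/

section LHV

variable {Λ : Type*} {R : (i : S.Agent) → (x : S.Setting i) → S.Outcome i x → Λ → ℝ}

theorem response_le_one (h0 : ∀ i x a l, 0 ≤ R i x a l) (h1 : ∀ i x l, ∑ a, R i x a l = 1)
    (i x a l) : R i x a l ≤ 1 := by
  rw [← h1 i x l]
  exact Finset.single_le_sum (f := fun a => R i x a l) (fun a _ => h0 i x a l)
    (Finset.mem_univ a)

variable [MeasurableSpace Λ] {μ : Measure Λ}

theorem isModel_of_lhv [IsProbabilityMeasure μ] {p : S.Behaviour}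
    (hm : ∀ i x a, Measurable (R i x a))
    (h0 : ∀ i x a l, 0 ≤ R i x a l) (h1 : ∀ i x l, ∑ a, R i x a l = 1)
    (hp : ∀ (x : S.Inputs) (a : S.Outputs x), p.prob x a = ∫ l, ∏ i, R i (x i) (a i) l ∂μ) :
    p.IsModel μ (fun _ => 1) R := by
  refine ⟨h1, fun x a => ?_, fun x a => by simpa using hp x a⟩
  refine Integrable.of_bound (C := 1) ?_ (Filter.Eventually.of_forall fun l => ?_)
  · exact (measurable_const.mul
      (Finset.measurable_prod _ fun i _ => hm i (x i) (a i))).aestronglyMeasurable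
  · rw [one_mul, Real.norm_of_nonneg (Finset.prod_nonneg fun i _ => h0 _ _ _ _)]
    exact Finset.prod_le_one (fun i _ => h0 _ _ _ _)
      fun i _ => response_le_one h0 h1 _ _ _ _

end LHV

/-- The CHSH inequality for a pair of local response functions, as a bound on the winning
probabilities of the CHSH game. -/
theorem chsh_le_three {a b : Fin 2 → Fin 2 → ℝ} (ha : ∀ k u, 0 ≤ a k u) (hb : ∀ k u, 0 ≤ b k u)
    (ha1 : ∀ k, a k 0 + a k 1 ≤ 1) (hb1 : ∀ k, b k 0 + b k 1 ≤ 1) :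
    a 0 0 * b 0 0 + a 0 1 * b 0 1 + (a 0 0 * b 1 0 + a 0 1 * b 1 1) +
      (a 1 0 * b 0 0 + a 1 1 * b 0 1) + (a 1 0 * b 1 1 + a 1 1 * b 1 0) ≤ 3 := by
  have mix : ∀ {p q X Y M : ℝ}, 0 ≤ p → 0 ≤ q → p + q ≤ 1 → X ≤ M → Y ≤ M → 0 ≤ M →
      p * X + q * Y ≤ M := by
    intro p q X Y M hp hq hpq hX hY hM
    nlinarith [mul_le_mul_of_nonneg_left hX hp, mul_le_mul_of_nonneg_left hY hq]
  have b00 := hb 0 0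
  have b01 := hb 0 1
  have b10 := hb 1 0
  have b11 := hb 1 1
  have c0 := hb1 0
  have c1 := hb1 1
  -- For fixed `b` the score is linear in each `a k`, so the better of the two outcomes bounds it.
  -- Weights may sum to less than 1, since settings can have further outcomes.
  have h0 := mix (ha 0 0) (ha 0 1) (ha1 0) (le_max_left (b 0 0 + b 1 0) (b 0 1 + b 1 1))
    (le_max_right _ _) (le_max_of_le_left (by linarith))
  have h1 := mix (ha 1 0) (ha 1 1) (ha1 1) (le_max_left (b 0 0 + b 1 1) (b 0 1 + b 1 0))
    (le_max_right _ _) (le_max_of_le_left (by linarith))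
  have h2 : max (b 0 0 + b 1 0) (b 0 1 + b 1 1) + max (b 0 0 + b 1 1) (b 0 1 + b 1 0) ≤ 3 := by
    rcases max_cases (b 0 0 + b 1 0) (b 0 1 + b 1 1) with h | h <;>
    rcases max_cases (b 0 0 + b 1 1) (b 0 1 + b 1 0) with h' | h' <;>
    rw [h.1, h'.1] <;> linarith
  linarith

theorem add_le_one_of_sum_eq_one {m : ℕ} {f : Fin m → ℝ} (h0 : ∀ a, 0 ≤ f a)
    (h1 : ∑ a, f a = 1) {a b : Fin m} (hab : a ≠ b) : f a + f b ≤ 1 := by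
  rw [← h1, ← Finset.sum_pair hab]
  exact Finset.sum_le_sum_of_subset_of_nonneg (Finset.subset_univ _) fun a _ _ => h0 a

/-- The outcome with label `u < 2`. -/
def bitOutcome (S : LFScenario) (i : S.Agent) (x : S.Setting i) (u : Fin 2) : S.Outcome i x :=
  ⟨u, lt_of_lt_of_le u.2 (S.two_le_numOutcomes i x)⟩

theorem bitOutcome_add_le_one {i : S.Agent} {x : S.Setting i} {f : S.Outcome i x → ℝ}
    (h0 : ∀ a, 0 ≤ f a) (h1 : ∑ a, f a = 1) :
    f (S.bitOutcome i x 0) + f (S.bitOutcome i x 1) ≤ 1 :=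
  add_le_one_of_sum_eq_one h0 h1 (by simp [bitOutcome, Fin.ext_iff])

theorem Behaviour.SharePRBox.notMem_B {p : S.Behaviour} {s t : S.Agent} (h : p.SharePRBox s t) :
    p ∉ S.B := by
  rintro ⟨Λ, _, μ, R, _, hm, h0, h1, hp⟩
  obtain ⟨hst, y, z, -, -, hPR⟩ := h
  have hmod := isModel_of_lhv hm h0 h1 hp
  have hcorr : ∀ k l u v : Fin 2, prBox k l u v =
      ∫ w, R s (y k) (S.bitOutcome s _ u) w * R t (z l) (S.bitOutcome t _ v) w ∂μ := by
    intro k l u v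
    -- The settings and outcomes of the agents other than `s` and `t` are arbitrary here.
    let x : S.Inputs := Function.update (Function.update S.query s (y k)) t (z l)
    have hxs : x s = y k := by simp [x, hst]
    have hxt : x t = z l := by simp [x]
    let a : S.Outputs x := fun i =>
      if i = s then S.bitOutcome i _ u else if i = t then S.bitOutcome i _ v
      else S.firstOutcome i _
    have has : a s = S.bitOutcome s _ u := by simp [a]
    have hat : a t = S.bitOutcome t _ v := by simp [a, hst.symm]
    rw [← hPR k l u v x a hxs hxt (by rw [has]; rfl) (by rw [hat]; rfl), hmod.marginal_eq]
    congr 1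
    ext w
    rw [one_mul, Finset.prod_pair hst, has, hat, hxs, hxt]
  have hint : ∀ k l u v : Fin 2, Integrable (fun w =>
      R s (y k) (S.bitOutcome s _ u) w * R t (z l) (S.bitOutcome t _ v) w) μ := by
    intro k l u v
    refine Integrable.of_bound (C := 1) ((hm _ _ _).mul (hm _ _ _)).aestronglyMeasurable
      (Filter.Eventually.of_forall fun w => ?_)
    rw [Real.norm_of_nonneg (mul_nonneg (h0 _ _ _ _) (h0 _ _ _ _))]
    exact mul_le_one₀ (response_le_one h0 h1 _ _ _ _) (h0 _ _ _ _)
      (response_le_one h0 h1 _ _ _ _)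
  have hle := integral_mono (μ := μ) (g := fun _ => (3 : ℝ))
    (((((hint 0 0 0 0).add (hint 0 0 1 1)).add ((hint 0 1 0 0).add (hint 0 1 1 1))).add
      ((hint 1 0 0 0).add (hint 1 0 1 1))).add ((hint 1 1 0 1).add (hint 1 1 1 0)))
    (integrable_const _)
    (fun w => chsh_le_three (a := fun k u => R s (y k) (S.bitOutcome s _ u) w)
      (b := fun l v => R t (z l) (S.bitOutcome t _ v) w) (fun _ _ => h0 _ _ _ _)
      (fun _ _ => h0 _ _ _ _)
      (fun _ => bitOutcome_add_le_one (f := fun a => R s _ a w) (fun _ => h0 _ _ _ _) (h1 _ _ _))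
      (fun _ => bitOutcome_add_le_one (f := fun a => R t _ a w) (fun _ => h0 _ _ _ _) (h1 _ _ _)))
  rw [integral_add' (((((hint 0 0 0 0).add (hint 0 0 1 1)).add
      ((hint 0 1 0 0).add (hint 0 1 1 1))).add
      ((hint 1 0 0 0).add (hint 1 0 1 1)))) ((hint 1 1 0 1).add (hint 1 1 1 0)),
    integral_add' (((hint 0 0 0 0).add (hint 0 0 1 1)).add
      ((hint 0 1 0 0).add (hint 0 1 1 1))) ((hint 1 0 0 0).add (hint 1 0 1 1)),
    integral_add' ((hint 0 0 0 0).add (hint 0 0 1 1)) ((hint 0 1 0 0).add (hint 0 1 1 1)),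
    integral_add' (hint 0 0 0 0) (hint 0 0 1 1), integral_add' (hint 0 1 0 0) (hint 0 1 1 1),
    integral_add' (hint 1 0 0 0) (hint 1 0 1 1), integral_add' (hint 1 1 0 1) (hint 1 1 1 0)]
    at hle
  simp only [← hcorr] at hle
  -- The eight winning probabilities are all 1/2, so `hle` reads 4 ≤ 3.
  norm_num [prBox, show (1 : Fin 2) + 1 = 0 from rfl] at hle


/-! ### LHV behaviours are LF behaviours -/

theorem prod_attach_filter_queried (x : S.Inputs) (f : S.Agent → ℝ) :
    ∏ i ∈ S.friends.attach.filter (fun i => x i.1 = S.query i.1), f i.1 =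
      ∏ i ∈ S.queried x, f i := by
  rw [queried, Finset.prod_filter, Finset.prod_filter,
    Finset.prod_attach S.friends (fun i => if x i = S.query i then f i else 1)]

theorem queryDelta_eq_ite (x : S.Inputs) (a : S.Outputs x) (c : S.FriendOutcomes) :
    S.queryDelta x a c =
      if ∀ i ∈ S.friends.attach.filter (fun i => x i.1 = S.query i.1), (a i.1 : ℕ) = (c i : ℕ)
      then 1 else 0 := by
  rw [queryDelta, Finset.prod_ite_zero, Finset.prod_const_one]
  congr

/-- If the friends' records are drawn from the query responses, the deltas fix the records of the
queried agents and the other records sum out. -/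
theorem sum_queryDelta_mul_prod (x : S.Inputs) (a : S.Outputs x)
    (R : (i : S.Agent) → (x : S.Setting i) → S.Outcome i x → ℝ)
    (h1 : ∀ i x, ∑ a, R i x a = 1) :
    ∑ c : S.FriendOutcomes, S.queryDelta x a c * ∏ i, R i.1 (S.query i.1) (c i) =
      ∏ i ∈ S.queried x, R i (x i) (a i) := by
  simp_rw [queryDelta_eq_ite, ite_mul, one_mul, zero_mul]
  rw [sum_pi_ite_forall_prod (κ := fun i : {i // i ∈ S.friends} => S.Outcome i.1 (S.query i.1)) _
    (fun i k => (a i.1 : ℕ) = (k : ℕ)) (fun i k => R i.1 (S.query i.1) k) (fun i _ => h1 _ _), ← prod_attach_filter_queried]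
  refine Finset.prod_congr rfl fun i hi => ?_
  have key : ∀ (y y' : S.Setting i.1) (b : S.Outcome i.1 y), y = y' →
      ∑ k : S.Outcome i.1 y', (if (b : ℕ) = (k : ℕ) then R i.1 y' k else 0) = R i.1 y b := by
    rintro y _ b rfl
    simp [← Fin.ext_iff]
  exact key _ _ _ (Finset.mem_filter.1 hi).2

/-- Given the hidden variable `l`, the record `c` has probability `G c l`. Bayes reweighting by `G c
l / P c` turns the LHV model into one for the behaviour given `c`; summing over `c` recovers `p`. -/
theorem B_subset_LF (S : LFScenario) : S.B ⊆ S.LF := by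
  rintro p ⟨Λ, _, μ, R, _, hm, h0, h1, hp⟩
  have hmod := isModel_of_lhv hm h0 h1 hp
  let G : S.FriendOutcomes → Λ → ℝ := fun c l => ∏ i, R i.1 (S.query i.1) (c i) l
  have hGm : ∀ c, Measurable (G c) := fun c => Finset.measurable_prod _ fun i _ => hm _ _ _
  have hG0 : ∀ c l, 0 ≤ G c l := fun c l => Finset.prod_nonneg fun i _ => h0 _ _ _ _
  have hG1 : ∀ c l, G c l ≤ 1 := fun c l =>
    Finset.prod_le_one (fun i _ => h0 _ _ _ _) fun i _ => response_le_one h0 h1 _ _ _ _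
  have hT0 : ∀ (J : Finset S.Agent) (x : S.Inputs) (a : S.Outputs x) l,
      0 ≤ ∏ i ∈ J, R i (x i) (a i) l :=
    fun J x a l => Finset.prod_nonneg fun i _ => h0 _ _ _ _
  have hT1 : ∀ (J : Finset S.Agent) (x : S.Inputs) (a : S.Outputs x) l,
      ∏ i ∈ J, R i (x i) (a i) l ≤ 1 := fun J x a l =>
    Finset.prod_le_one (fun i _ => h0 _ _ _ _) fun i _ => response_le_one h0 h1 _ _ _ _
  have hGi : ∀ c, Integrable (G c) μ := fun c =>
    Integrable.of_bound (C := 1) (hGm c).aestronglyMeasurable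
      (Filter.Eventually.of_forall fun l => by
        rw [Real.norm_of_nonneg (hG0 c l)]
        exact hG1 c l)
  have hGT : ∀ c (J : Finset S.Agent) (x : S.Inputs) (a : S.Outputs x),
      Integrable (fun l => G c l * ∏ i ∈ J, R i (x i) (a i) l) μ := fun c J x a =>
    Integrable.of_bound (C := 1)
      ((hGm c).mul (Finset.measurable_prod _ fun i _ => hm _ _ _)).aestronglyMeasurable
      (Filter.Eventually.of_forall fun l => by
        rw [Real.norm_of_nonneg (mul_nonneg (hG0 c l) (hT0 J x a l))]
        exact mul_le_one₀ (hG1 c l) (hT0 J x a l) (hT1 J x a l))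
  let P : S.FriendOutcomes → ℝ := fun c => ∫ l, G c l ∂μ
  have hP0 : ∀ c, 0 ≤ P c := fun c => integral_nonneg (hG0 c)
  have hQ : ∀ c, ∃ q : S.Behaviour, q.LocalAgency ∧ ∀ (J : Finset S.Agent) (x : S.Inputs)
      (a : S.Outputs x), q.marginal J x a * P c = ∫ l, G c l * ∏ i ∈ J, R i (x i) (a i) l ∂μ := by
    intro c
    by_cases hc : P c = 0
    -- A record of probability zero contributes nothing, so any behaviour with local agency will do.
    · refine ⟨p, hmod.localAgency, fun J x a => ?_⟩
      rw [hc, mul_zero]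
      refine le_antisymm (integral_nonneg fun l => mul_nonneg (hG0 c l) (hT0 J x a l)) ?_
      rw [← hc]
      exact integral_mono (hGT c J x a) (hGi c)
        fun l => mul_le_of_le_one_right (hG0 c l) (hT1 J x a l)
    · have hint : ∀ (J : Finset S.Agent) (x : S.Inputs) (a : S.Outputs x),
          Integrable (fun l => (P c)⁻¹ * G c l * ∏ i ∈ J, R i (x i) (a i) l) μ := by
        intro J x a
        simpa only [mul_assoc] using (hGT c J x a).const_mul (P c)⁻¹
      let q : S.Behaviour := Behaviour.ofModel μ (fun l => (P c)⁻¹ * G c l) R h1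
        (fun x a => hint _ x a)
        (by rw [integral_const_mul]; exact inv_mul_cancel₀ hc)
        (fun x a => integral_nonneg fun l =>
          mul_nonneg (mul_nonneg (inv_nonneg.2 (hP0 c)) (hG0 c l)) (hT0 _ x a l))
      have hq : q.IsModel μ (fun l => (P c)⁻¹ * G c l) R :=
        ⟨h1, fun x a => hint _ x a, fun _ _ => rfl⟩
      refine ⟨q, hq.localAgency, fun J x a => ?_⟩
      rw [hq.marginal_eq]
      simp only [mul_assoc]
      rw [integral_const_mul]
      field_simp
  choose Q hQla hQ using hQ
  refine ⟨P, Q, hP0, ?_, hQla, fun x a => ?_⟩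
  · rw [← integral_finsetSum _ fun c _ => hGi c]
    have : ∀ l, ∑ c, G c l = 1 := fun l => by
      rw [← Fintype.prod_sum (fun (i : {i // i ∈ S.friends}) k => R i.1 (S.query i.1) k l)]
      simp [h1]
    simp [this]
  · simp_rw [mul_assoc, hQ, ← integral_const_mul]
    rw [← integral_finsetSum _ fun c _ => (hGT c _ x a).const_mul _, hp]
    congr 1
    ext l
    simp_rw [← mul_assoc]
    rw [← Finset.sum_mul, sum_queryDelta_mul_prod x a (fun i x a => R i x a l)
      fun i x => h1 i x l, mul_comm, Finset.prod_sdiff (Finset.subset_univ _)]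


/-! ### LF behaviours are LHV when all agents but one have a friend and two settings -/

theorem mem_B_of_fintype {p : S.Behaviour} {Λ : Type} [Fintype Λ] (w : Λ → ℝ)
    (hw0 : ∀ l, 0 ≤ w l) (hw1 : ∑ l, w l = 1)
    (R : (i : S.Agent) → (x : S.Setting i) → S.Outcome i x → Λ → ℝ)
    (h0 : ∀ i x a l, 0 ≤ R i x a l) (h1 : ∀ i x l, ∑ a, R i x a l = 1)
    (hp : ∀ (x : S.Inputs) (a : S.Outputs x), p.prob x a = ∑ l, w l * ∏ i, R i (x i) (a i) l) :
    p ∈ S.B := by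
  let _ : MeasurableSpace Λ := ⊤
  have hsum : ∑ l, ENNReal.ofReal (w l) = 1 := by
    rw [← ENNReal.ofReal_sum_of_nonneg fun l _ => hw0 l, hw1, ENNReal.ofReal_one]
  let ν : PMF Λ := PMF.ofFintype (fun l => ENNReal.ofReal (w l)) hsum
  refine ⟨Λ, ⊤, ν.toMeasure, R, inferInstance, fun _ _ _ => measurable_from_top, h0, h1,
    fun x a => ?_⟩
  rw [PMF.integral_eq_sum, hp]
  refine Finset.sum_congr rfl fun l _ => ?_
  simp [ν, hw0]

/-- The local agency condition, for an outcome string of only one of the two contexts. -/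
theorem Behaviour.LocalAgency.marginal_eq_sum {q : S.Behaviour} (h : q.LocalAgency)
    (V : Finset S.Agent) (x x' : S.Inputs) (a : S.Outputs x) (hx : ∀ i ∈ V, x i = x' i) :
    q.marginal V x a =
      ∑ b : S.Outputs x', if ∀ i ∈ V, (b i : ℕ) = (a i : ℕ) then q.prob x' b else 0 := by
  have key : ∀ i, ∃ k : S.Outcome i (x' i), i ∈ V → (a i : ℕ) = (k : ℕ) := by
    intro i
    by_cases hi : i ∈ V
    -- On `V` the label is transported along the equality of settings; off `V` any outcome serves.
    · exact ⟨finCongr (by rw [hx i hi]) (a i), fun _ => rfl⟩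
    · exact ⟨S.firstOutcome i _, fun hi' => absurd hi' hi⟩
  choose a' ha' using key
  rw [h V x x' a a' hx fun i hi => ha' i hi, Behaviour.marginal]
  refine Finset.sum_congr rfl fun b _ => if_congr ?_ rfl rfl
  exact forall₂_congr fun i hi => by rw [Fin.ext_iff, ha' i hi]

/-- The second setting of agent `i`. -/
def second (S : LFScenario) (i : S.Agent) : S.Setting i :=
  ⟨1, lt_of_lt_of_le Nat.one_lt_two (S.two_le_numSettings i)⟩

/-- The context in which agent `j` chooses `y` and all the others their second setting. -/
def context (S : LFScenario) (j : S.Agent) (y : S.Setting j) : S.Inputs :=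
  Function.update S.second j y

/-- Outcomes, for the second settings, of all the agents but `j`. -/
abbrev OtherOutcomes (S : LFScenario) (j : S.Agent) : Type :=
  (i : {i : S.Agent // i ≠ j}) → S.Outcome i (S.second i)

/-- An outcome string splits into the outcome of agent `j` and those of the others. -/
def splitOutputs (S : LFScenario) (j : S.Agent) (y : S.Setting j) :
    S.Outputs (S.context j y) ≃ S.Outcome j y × S.OtherOutcomes j :=
  (Equiv.piSplitAt j _).trans (Equiv.prodCongr (finCongr (by simp [context]))
    (Equiv.piCongrRight fun i => finCongr (by simp [context, i.2])))

theorem splitOutputs_symm_self (j : S.Agent) (y : S.Setting j) (k : S.Outcome j y)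
    (b : S.OtherOutcomes j) : ((S.splitOutputs j y).symm (k, b) j : ℕ) = k := by
  simp [splitOutputs]

theorem splitOutputs_symm_ne (j : S.Agent) (y : S.Setting j) (k : S.Outcome j y)
    (b : S.OtherOutcomes j) {i : S.Agent} (hi : i ≠ j) :
    ((S.splitOutputs j y).symm (k, b) i : ℕ) = b ⟨i, hi⟩ := by
  simp [splitOutputs, hi]

namespace Behaviour

/-- The probability of the outcome `k` of agent `j` for `y` and the outcomes `b` of the others for
their second settings. -/
def splitProb (q : S.Behaviour) (j : S.Agent) (b : S.OtherOutcomes j) (y : S.Setting j)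
    (k : S.Outcome j y) : ℝ :=
  q.prob (S.context j y) ((S.splitOutputs j y).symm (k, b))

theorem splitProb_nonneg (q : S.Behaviour) (j : S.Agent) (b : S.OtherOutcomes j)
    (y : S.Setting j) (k : S.Outcome j y) : 0 ≤ q.splitProb j b y k :=
  q.prob_nonneg _ _

/-- The probability of the outcomes `b` of the agents other than `j` for their second settings. -/
def otherProb (q : S.Behaviour) (j : S.Agent) (b : S.OtherOutcomes j) : ℝ :=
  ∑ k, q.splitProb j b (S.second j) k

theorem otherProb_nonneg (q : S.Behaviour) (j : S.Agent) (b : S.OtherOutcomes j) :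
    0 ≤ q.otherProb j b :=
  Finset.sum_nonneg fun _ _ => q.splitProb_nonneg _ _ _ _

theorem sum_otherProb (q : S.Behaviour) (j : S.Agent) : ∑ b, q.otherProb j b = 1 := by
  rw [← q.sum_prob (S.context j (S.second j)), ← (S.splitOutputs j (S.second j)).symm.sum_comp,
    Fintype.sum_prod_type_right]
  rfl

variable {q : S.Behaviour}

theorem LocalAgency.marginal_eq_sum_splitProb (h : q.LocalAgency) (j : S.Agent)
    (J : Finset S.Agent) (x : S.Inputs) (a : S.Outputs x) (y : S.Setting j)
    (hJ : ∀ i ∈ J, x i = S.context j y i) :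
    q.marginal J x a = ∑ b : S.OtherOutcomes j,
      if ∀ i : {i // i ≠ j}, i.1 ∈ J → (a i.1 : ℕ) = (b i : ℕ) then
        ∑ k : S.Outcome j y, (if j ∈ J → (k : ℕ) = (a j : ℕ) then q.splitProb j b y k else 0) else 0 := by
  rw [h.marginal_eq_sum J x (S.context j y) a hJ, ← (S.splitOutputs j y).symm.sum_comp,
    Fintype.sum_prod_type_right]
  refine Finset.sum_congr rfl fun b _ => ?_
  have hsplit : ∀ k : S.Outcome j y,
      (∀ i ∈ J, ((S.splitOutputs j y).symm (k, b) i : ℕ) = (a i : ℕ)) ↔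
        (∀ i : {i // i ≠ j}, i.1 ∈ J → (a i.1 : ℕ) = (b i : ℕ)) ∧
          (j ∈ J → (k : ℕ) = (a j : ℕ)) := by
    intro k
    constructor
    · intro hk
      refine ⟨fun i hi => ?_, fun hj => ?_⟩
      · rw [← hk i.1 hi, splitOutputs_symm_ne j y k b i.2]
      · rw [← hk j hj, splitOutputs_symm_self]
    · rintro ⟨h1, h2⟩ i hi
      by_cases hij : i = j
      · subst hij
        rw [splitOutputs_symm_self, h2 hi]
      · rw [splitOutputs_symm_ne j y k b hij, h1 ⟨i, hij⟩ hi]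
  split_ifs with hb
  · exact Finset.sum_congr rfl fun k _ => if_congr ((hsplit k).trans (and_iff_right hb)) rfl rfl
  · exact Finset.sum_eq_zero fun k _ => if_neg fun hk => hb ((hsplit k).1 hk).1

/-- This is local agency for the set of all agents but `j`: their statistics do not depend on the
setting of `j`. -/
theorem LocalAgency.sum_splitProb (h : q.LocalAgency) (j : S.Agent) (b : S.OtherOutcomes j)
    (y : S.Setting j) : ∑ k, q.splitProb j b y k = q.otherProb j b := by
  have key : ∀ y' : S.Setting j, q.marginal (Finset.univ.erase j) (S.context j y)
      ((S.splitOutputs j y).symm (S.firstOutcome j y, b)) = ∑ k, q.splitProb j b y' k := by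
    intro y'
    rw [h.marginal_eq_sum_splitProb j _ _ _ y' fun i hi => by
      simp [context, Finset.ne_of_mem_erase hi], Finset.sum_eq_single b]
    · rw [if_pos fun i _ => splitOutputs_symm_ne j y _ b i.2]
      simp
    · intro b' _ hb'
      refine if_neg fun hb => hb' (funext fun i => Fin.ext ?_)
      rw [← hb i (by simp [i.2]), splitOutputs_symm_ne j y _ b i.2]
    · simp
  rw [← key y, key (S.second j)]
  rfl

theorem LocalAgency.marginal_eq_sum_of_mem (h : q.LocalAgency) {j : S.Agent}
    {J : Finset S.Agent} (hj : j ∈ J) (x : S.Inputs) (a : S.Outputs x)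
    (hJ : ∀ i ∈ J, i ≠ j → x i = S.second i) :
    q.marginal J x a = ∑ b : S.OtherOutcomes j,
      if ∀ i : {i // i ≠ j}, i.1 ∈ J → (a i.1 : ℕ) = (b i : ℕ) then
        q.splitProb j b (x j) (a j) else 0 := by
  rw [h.marginal_eq_sum_splitProb j J x a (x j)]
  · refine Finset.sum_congr rfl fun b _ => if_congr Iff.rfl ?_ rfl
    simp [hj, ← Fin.ext_iff]
  · intro i hi
    by_cases hij : i = j
    · subst hij
      simp [context]
    · simp [context, hij, hJ i hi hij]

theorem LocalAgency.marginal_eq_sum_of_notMem (h : q.LocalAgency) {j : S.Agent}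
    {J : Finset S.Agent} (hj : j ∉ J) (x : S.Inputs) (a : S.Outputs x)
    (hJ : ∀ i ∈ J, i ≠ j → x i = S.second i) :
    q.marginal J x a = ∑ b : S.OtherOutcomes j,
      if ∀ i : {i // i ≠ j}, i.1 ∈ J → (a i.1 : ℕ) = (b i : ℕ) then q.otherProb j b else 0 := by
  rw [h.marginal_eq_sum_splitProb j J x a (S.second j)]
  · simp only [hj, false_imp_iff, if_true]
    rfl
  · intro i hi
    have hij : i ≠ j := fun hij => hj (hij ▸ hi)
    simp [context, hij, hJ i hi hij]

/-- The probability of the outcome `k` of agent `j` for `y`, given the outcomes `b` of the others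
for their second settings. -/
noncomputable def condProb (q : S.Behaviour) (j : S.Agent) (b : S.OtherOutcomes j)
    (y : S.Setting j) (k : S.Outcome j y) : ℝ :=
  if q.otherProb j b = 0 then (if k = S.firstOutcome j y then 1 else 0)
  else q.splitProb j b y k / q.otherProb j b

theorem condProb_nonneg (q : S.Behaviour) (j : S.Agent) (b : S.OtherOutcomes j)
    (y : S.Setting j) (k : S.Outcome j y) : 0 ≤ q.condProb j b y k := by
  unfold condProb
  split_ifs
  · exact zero_le_one
  · exact le_rfl
  · exact div_nonneg (q.splitProb_nonneg _ _ _ _) (q.otherProb_nonneg _ _)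

theorem LocalAgency.sum_condProb (h : q.LocalAgency) (j : S.Agent) (b : S.OtherOutcomes j)
    (y : S.Setting j) : ∑ k, q.condProb j b y k = 1 := by
  unfold condProb
  split_ifs with hb
  · simp
  · rw [← Finset.sum_div, h.sum_splitProb, div_self hb]

/-- If `b` has probability zero, the default value of `condProb` is harmless: by local agency the
joint probability vanishes for every setting `y`. -/
theorem LocalAgency.otherProb_mul_condProb (h : q.LocalAgency) (j : S.Agent)
    (b : S.OtherOutcomes j) (y : S.Setting j) (k : S.Outcome j y) :
    q.otherProb j b * q.condProb j b y k = q.splitProb j b y k := by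
  unfold condProb
  split_ifs with hb hk
  all_goals try rw [mul_div_cancel₀ _ hb]
  all_goals
    rw [hb, zero_mul]
    rw [← h.sum_splitProb j b y, Finset.sum_eq_zero_iff_of_nonneg
      fun k _ => q.splitProb_nonneg _ _ _ _] at hb
    exact (hb k (Finset.mem_univ k)).symm

end Behaviour

/-- The local response functions for the hidden variable `(c, b)`, where `c` are the outcomes of
the friends and `b` the outcomes of the agents other than `j` for their second settings. -/
noncomputable def hiddenResponse (S : LFScenario) (j : S.Agent)
    (Q : S.FriendOutcomes → S.Behaviour) (i : S.Agent) (x : S.Setting i) (a : S.Outcome i x)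
    (l : S.FriendOutcomes × S.OtherOutcomes j) : ℝ :=
  if h : i ∈ S.friends ∧ x = S.query i then (if (a : ℕ) = (l.1 ⟨i, h.1⟩ : ℕ) then 1 else 0)
  else if h : i = j then
    (Q l.1).condProb i (fun i' => l.2 ⟨i'.1, h ▸ i'.2⟩) x a
  else (if (a : ℕ) = (l.2 ⟨i, h⟩ : ℕ) then 1 else 0)

theorem sum_ite_val_eq {m n : ℕ} (hmn : n = m) (k : Fin n) :
    ∑ a : Fin m, (if (a : ℕ) = (k : ℕ) then (1 : ℝ) else 0) = 1 := by
  subst hmn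
  simp [← Fin.ext_iff]

theorem eq_second_of_ne_query {i : S.Agent} (hi : S.numSettings i = 2) {x : S.Setting i}
    (hx : x ≠ S.query i) : x = S.second i := by
  have := x.2
  rw [query, Ne, Fin.ext_iff] at hx
  rw [second, Fin.ext_iff]
  simp only at hx ⊢
  omega

theorem LF_subset_B (S : LFScenario) {j : S.Agent}
    (hj : ∀ i, i ≠ j → i ∈ S.friends ∧ S.numSettings i = 2) : S.LF ⊆ S.B := by
  rintro p ⟨P, Q, hP0, hP1, hQ, hp⟩
  refine mem_B_of_fintype (Λ := S.FriendOutcomes × S.OtherOutcomes j)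
    (fun l => P l.1 * (Q l.1).otherProb j l.2)
    (fun l => mul_nonneg (hP0 _) ((Q l.1).otherProb_nonneg _ _)) ?_ (S.hiddenResponse j Q) ?_ ?_ ?_
  · rw [Fintype.sum_prod_type]
    simp_rw [← Finset.mul_sum, Behaviour.sum_otherProb, mul_one]
    exact hP1
  · intro i x a l
    unfold hiddenResponse
    split_ifs <;> first | exact zero_le_one | exact le_rfl | exact Behaviour.condProb_nonneg ..
  · intro i x l
    unfold hiddenResponse
    split_ifs with h1 h2
    · exact sum_ite_val_eq (congrArg (S.numOutcomes i) h1.2.symm) _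
    · exact (hQ l.1).sum_condProb _ _ _
    · refine sum_ite_val_eq ?_ _
      obtain ⟨hf, h2⟩ := hj i h2
      rw [eq_second_of_ne_query h2 fun hx => h1 ⟨hf, hx⟩]
  · intro x a
    rw [hp, Fintype.sum_prod_type]
    refine Finset.sum_congr rfl fun c _ => ?_
    have hmem : ∀ i, i ∈ S.queried x ↔ i ∈ S.friends ∧ x i = S.query i := fun i =>
      Finset.mem_filter
    set J := Finset.univ \ S.queried x with hJdef
    have hJ : ∀ i, i ∈ J ↔ ¬ (i ∈ S.friends ∧ x i = S.query i) := fun i => by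
      simp [hJdef, hmem]
    have hJ2 : ∀ i ∈ J, i ≠ j → x i = S.second i := fun i hi hij =>
      eq_second_of_ne_query (hj i hij).2 fun hx => (hJ i).1 hi ⟨(hj i hij).1, hx⟩
    -- Queried agents read off `c`, including `j` if it has a friend.
    have hdelta : ∀ b, ∏ i ∈ S.queried x, S.hiddenResponse j Q i (x i) (a i) (c, b) =
        S.queryDelta x a c := by
      intro b
      rw [← prod_attach_filter_queried, queryDelta]
      refine Finset.prod_congr rfl fun i hi => ?_
      exact dif_pos ⟨i.2, (Finset.mem_filter.1 hi).2⟩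
    have hother : ∀ b : S.OtherOutcomes j,
        ∏ i ∈ J.erase j, S.hiddenResponse j Q i (x i) (a i) (c, b) =
          if ∀ i : {i // i ≠ j}, i.1 ∈ J → (a i.1 : ℕ) = (b i : ℕ) then 1 else 0 := by
      intro b
      have hval : ∀ i (hi : i ≠ j), i ∈ J → S.hiddenResponse j Q i (x i) (a i) (c, b) =
          if (a i : ℕ) = (b ⟨i, hi⟩ : ℕ) then 1 else 0 := fun i hi hiJ => by
        rw [hiddenResponse, dif_neg ((hJ i).1 hiJ), dif_neg hi]
      split_ifs with hb
      · refine Finset.prod_eq_one fun i hi => ?_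
        rw [Finset.mem_erase] at hi
        rw [hval i hi.1 hi.2, if_pos (hb ⟨i, hi.1⟩ hi.2)]
      · push Not at hb
        obtain ⟨i, hiJ, hi⟩ := hb
        exact Finset.prod_eq_zero (Finset.mem_erase.2 ⟨i.2, hiJ⟩)
          (by rw [hval i.1 i.2 hiJ, if_neg hi])
    have hsplit : ∀ b, ∏ i, S.hiddenResponse j Q i (x i) (a i) (c, b) =
        (∏ i ∈ J, S.hiddenResponse j Q i (x i) (a i) (c, b)) * S.queryDelta x a c := fun b => by
      rw [← hdelta b, hJdef, Finset.prod_sdiff (Finset.subset_univ _)]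
    have hmarg : (Q c).marginal J x a = ∑ b, (Q c).otherProb j b *
        ∏ i ∈ J, S.hiddenResponse j Q i (x i) (a i) (c, b) := by
      -- If `j` is not queried, the chain rule gives its joint probability with `b`; otherwise its
      -- outcome is summed out and only the law of `b` is left.
      by_cases hjJ : j ∈ J
      · rw [(hQ c).marginal_eq_sum_of_mem hjJ x a hJ2]
        refine Finset.sum_congr rfl fun b _ => ?_
        have hr : S.hiddenResponse j Q j (x j) (a j) (c, b) =
            (Q c).condProb j b (x j) (a j) := by
          rw [hiddenResponse, dif_neg ((hJ j).1 hjJ), dif_pos rfl]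
        rw [← Finset.mul_prod_erase _ _ hjJ, hother, hr, ← mul_assoc,
          (hQ c).otherProb_mul_condProb, mul_ite, mul_one, mul_zero]
      · rw [(hQ c).marginal_eq_sum_of_notMem hjJ x a hJ2]
        refine Finset.sum_congr rfl fun b _ => ?_
        rw [← Finset.erase_eq_of_notMem hjJ, hother, Finset.erase_eq_of_notMem hjJ, mul_ite,
          mul_one, mul_zero]
    rw [hmarg, Finset.mul_sum, Finset.sum_mul]
    refine Finset.sum_congr rfl fun b _ => ?_
    rw [hsplit]
    ring


/-! ### An LF behaviour with a PR box -/

/-- When the revealed outcomes are always the first ones, the record can be the constant `c₀` and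
`p` itself can serve as the behaviour given the record. -/
theorem Behaviour.LocalAgency.mem_LF {p : S.Behaviour} (h : p.LocalAgency)
    (h0 : ∀ (x : S.Inputs) (a : S.Outputs x), p.prob x a ≠ 0 →
      ∀ i ∈ S.queried x, (a i : ℕ) = 0) : p ∈ S.LF := by
  let c₀ : S.FriendOutcomes := fun i => S.firstOutcome i.1 (S.query i.1)
  refine ⟨fun c => if c = c₀ then 1 else 0, fun _ => p,
    fun c => ite_nonneg zero_le_one le_rfl, by simp, fun _ => h, fun x a => ?_⟩
  simp only [mul_ite, mul_one, mul_zero, Finset.sum_ite_eq',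
    Finset.mem_univ, if_true]
  have hd : S.queryDelta x a c₀ =
      ∏ i ∈ S.queried x, if (a i : ℕ) = 0 then (1 : ℝ) else 0 :=
    prod_attach_filter_queried x fun i => if (a i : ℕ) = 0 then (1 : ℝ) else 0
  rw [hd, Finset.prod_ite_zero, Finset.prod_const_one]
  split_ifs with ha
  · rw [one_mul, Behaviour.marginal, Finset.sum_eq_single a]
    · simp
    · intro b _ hb
      split_ifs with hba
      -- A string of nonzero probability that agrees with `a` off the queried agents also agrees on
      -- them, where both labels are 0; so the marginal has one term.
      · by_contra hne
        refine hb (funext fun i => ?_)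
        by_cases hi : i ∈ S.queried x
        · exact Fin.ext ((h0 x b hne i hi).trans (ha i hi).symm)
        · exact hba i (by simp [hi])
      · rfl
    · simp
  · rw [zero_mul]
    by_contra hne
    exact ha (h0 x a hne)

/-- The input to a shared box that corresponds to a setting of agent `i`: the settings that are
not query measurements of agents with a friend are numbered from `0`; a query measurement gives
the input `2`. -/
def boxInput (S : LFScenario) (i : S.Agent) (x : S.Setting i) : ℕ :=
  if i ∈ S.friends then (if x = S.query i then 2 else (x : ℕ) - 1) else x

/-- The (signed) bias of the first party in the PR box, for the input `k`. -/
noncomputable def leftBias (k : ℕ) (l : Bool × Bool) : ℝ :=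
  if 2 ≤ k then 1 / 2 else if (k = 1 ↔ l.1) then (if l.2 then 1 else -1) else 0

/-- The bias of the second party in the PR box, for the input `k`. -/
noncomputable def rightBias (k : ℕ) (l : Bool × Bool) : ℝ :=
  if 2 ≤ k then 1 / 2 else (if l.2 then 1 / 2 else -(1 / 2)) * (if k = 1 ∧ l.1 then -1 else 1)

/-- The left biases ±1 give quasi-probabilities 3/2 and -1/2. They occur for half of the hidden
values and the bias is 0 for the rest, which brings the correlators to exactly ±1; negativity
disappears on summing over the four values. -/
theorem sum_bias_mul_bias_nonneg (k k' m n : ℕ) :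
    0 ≤ ∑ l, bias (leftBias k l) m * bias (rightBias k' l) n := by
  rcases k with _ | _ | k <;> rcases k' with _ | _ | k' <;> rcases m with _ | _ | m <;>
    rcases n with _ | _ | n <;>
    norm_num [Fintype.sum_prod_type, bias, leftBias, rightBias]

theorem sum_bias_mul_bias (k l u v : Fin 2) :
    ∑ w, 1 / 4 * (bias (leftBias k w) u * bias (rightBias l w) v) = prBox k l u v := by
  fin_cases k <;> fin_cases l <;> fin_cases u <;> fin_cases v <;>
    norm_num [Fintype.sum_prod_type, bias, leftBias, rightBias, prBox,
      show (1 : Fin 2) + 1 = 0 from rfl]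

/-- Response functions for a PR box shared by `s` and `t`. -/
noncomputable def boxResponse (S : LFScenario) (s t i : S.Agent) (x : S.Setting i)
    (a : S.Outcome i x) (l : Bool × Bool) : ℝ :=
  bias (if i = s then leftBias (S.boxInput i x) l
    else if i = t then rightBias (S.boxInput i x) l else 1 / 2) a

theorem boxResponse_of_query {s t i : S.Agent} (hi : i ∈ S.friends) {x : S.Setting i}
    (hx : x = S.query i) {a : S.Outcome i x} (ha : (a : ℕ) ≠ 0) (l : Bool × Bool) :
    S.boxResponse s t i x a l = 0 := by
  simp [boxResponse, boxInput, hi, hx, leftBias, rightBias, bias, ha]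

theorem exists_boxInput_eq {i : S.Agent} (hi : i ∉ S.friends ∨ S.numSettings i ≠ 2) :
    ∃ y : Fin 2 → S.Setting i, y 0 ≠ y 1 ∧ ∀ k, S.boxInput i (y k) = k := by
  have h2 := S.two_le_numSettings i
  by_cases hf : i ∈ S.friends
  · have h3 : 3 ≤ S.numSettings i := by
      have := hi.resolve_left (not_not.2 hf)
      omega
    -- The shift skips the query, which is why an agent with a friend needs three settings.
    refine ⟨fun k => ⟨k + 1, by omega⟩, by simp, fun k => ?_⟩
    rw [boxInput, if_pos hf, if_neg fun h => Nat.succ_ne_zero _ (congrArg Fin.val h)]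
    rfl
  · exact ⟨fun k => ⟨k, by omega⟩, by simp, fun k => by simp [boxInput, hf]⟩

theorem exists_sharePRBox {s t : S.Agent} (hst : s ≠ t)
    (hs : s ∉ S.friends ∨ S.numSettings s ≠ 2) (ht : t ∉ S.friends ∨ S.numSettings t ≠ 2) :
    ∃ p ∈ S.LF, p.SharePRBox s t := by
  have hsum : ∀ i x l, ∑ a, S.boxResponse s t i x a l = 1 := fun i x l =>
    sum_bias (S.two_le_numOutcomes i x) _
  let p : S.Behaviour := Behaviour.ofModel Measure.count (fun _ => 1 / 4) (S.boxResponse s t) hsum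
    (fun _ _ => Integrable.of_finite) (by simp [integral_fintype]) (fun x a => by
      rw [integral_fintype Integrable.of_finite]
      -- Only the factors of `s` and `t` depend on `l`; bias 1/2 makes every other agent output the
      -- first label.
      have hsplit : ∀ l, ∏ i, S.boxResponse s t i (x i) (a i) l =
          bias (leftBias (S.boxInput s (x s)) l) (a s) *
            bias (rightBias (S.boxInput t (x t)) l) (a t) *
            ∏ i ∈ (Finset.univ.erase s).erase t, bias (1 / 2) (a i) := by
        intro l
        rw [← Finset.mul_prod_erase _ _ (Finset.mem_univ s), ← Finset.mul_prod_erase _ _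
          (Finset.mem_erase.2 ⟨hst.symm, Finset.mem_univ t⟩), ← mul_assoc]
        congr 1
        · simp [boxResponse, hst.symm]
        · refine Finset.prod_congr rfl fun i hi => ?_
          simp only [Finset.mem_erase] at hi
          simp [boxResponse, hi.1, hi.2.1]
      simp_rw [hsplit]
      simp only [Measure.real, Measure.count_singleton, ENNReal.toReal_one, one_smul]
      rw [← Finset.mul_sum, ← Finset.sum_mul]
      refine mul_nonneg (by norm_num) (mul_nonneg (sum_bias_mul_bias_nonneg _ _ _ _)
        (Finset.prod_nonneg fun i _ => ?_))
      unfold bias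
      split_ifs <;> norm_num)
  have hmod : p.IsModel Measure.count (fun _ => 1 / 4) (S.boxResponse s t) :=
    ⟨hsum, fun _ _ => Integrable.of_finite, fun _ _ => rfl⟩
  refine ⟨p, hmod.localAgency.mem_LF fun x a hne i hi => ?_, hst, ?_⟩
  · by_contra ha
    refine hne ((hmod.2.2 x a).trans ?_)
    rw [queried, Finset.mem_filter] at hi
    have : ∀ l, ∏ i, S.boxResponse s t i (x i) (a i) l = 0 := fun l =>
      Finset.prod_eq_zero (Finset.mem_univ i) (boxResponse_of_query hi.1 hi.2 ha l)
    simp [this]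
  · obtain ⟨y, hy, hyk⟩ := exists_boxInput_eq hs
    obtain ⟨z, hz, hzk⟩ := exists_boxInput_eq ht
    refine ⟨y, z, hy, hz, fun k l u v x a hxs hxt has hat => ?_⟩
    rw [hmod.marginal_eq, integral_fintype Integrable.of_finite, ← sum_bias_mul_bias]
    simp [Finset.prod_pair hst, boxResponse, hst.symm, Measure.real, hxs, hxt, hyk, hzk, has, hat]


/-! ### Reduction of the two alternatives and conclusion -/

theorem exists_agent_iff (S : LFScenario) :
    ((S.friends.card + 1 = S.numAgents ∧ ∀ j ∈ S.friends, S.numSettings j = 2) ∨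
      (S.friends = Finset.univ ∧
        S.numAgents ≤ (Finset.univ.filter fun i => S.numSettings i = 2).card + 1)) ↔
    ∃ j : S.Agent, ∀ i, i ≠ j → i ∈ S.friends ∧ S.numSettings i = 2 := by
  have hN := S.two_le_numAgents
  have hcompl : ∀ T : Finset S.Agent, S.numAgents ≤ T.card + 1 → ∃ j, ∀ i, i ≠ j → i ∈ T := by
    intro T hT
    have hc : Tᶜ.card ≤ 1 := by
      rw [Finset.card_compl, Fintype.card_fin]
      omega
    have : Nonempty S.Agent := ⟨⟨0, by omega⟩⟩
    obtain ⟨j, hj⟩ := Finset.card_le_one_iff_subset_singleton.1 hc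
    refine ⟨j, fun i hi => ?_⟩
    by_contra hiT
    exact hi (Finset.mem_singleton.1 (hj (Finset.mem_compl.2 hiT)))
  have hcard : ∀ (T : Finset S.Agent) (j : S.Agent), (∀ i, i ≠ j → i ∈ T) →
      S.numAgents ≤ T.card + 1 := by
    intro T j hT
    have h1 := Finset.card_le_card (s := Finset.univ.erase j) (t := T)
      fun i hi => hT i (Finset.ne_of_mem_erase hi)
    rw [Finset.card_erase_of_mem (Finset.mem_univ j), Finset.card_univ, Fintype.card_fin] at h1
    omega
  constructor
  · rintro (⟨hF, h2⟩ | ⟨hF, h2⟩)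
    · obtain ⟨j, hj⟩ := hcompl S.friends hF.ge
      exact ⟨j, fun i hi => ⟨hj i hi, h2 i (hj i hi)⟩⟩
    · obtain ⟨j, hj⟩ := hcompl _ h2
      exact ⟨j, fun i hi => ⟨hF ▸ Finset.mem_univ i, (Finset.mem_filter.1 (hj i hi)).2⟩⟩
  · rintro ⟨j, hj⟩
    -- Whether the exceptional agent `j` has a friend decides between the two alternatives.
    by_cases hjF : j ∈ S.friends
    · refine Or.inr ⟨Finset.eq_univ_iff_forall.2 fun i => ?_, hcard _ j fun i hi => ?_⟩
      · by_cases hi : i = j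
        · exact hi ▸ hjF
        · exact (hj i hi).1
      · simp [(hj i hi).2]
    · refine Or.inl ⟨le_antisymm ?_ (hcard _ j fun i hi => (hj i hi).1), fun i hi => ?_⟩
      · have := Finset.card_lt_univ_of_notMem hjF
        rw [Fintype.card_fin] at this
        omega
      · exact (hj i fun hij => hjF (hij ▸ hi)).2

theorem exists_mem_LF_sharePRBox (S : LFScenario)
    (h : ¬ ∃ j : S.Agent, ∀ i, i ≠ j → i ∈ S.friends ∧ S.numSettings i = 2) :
    ∃ p ∈ S.LF, p ∉ S.B ∧ ∃ s t : S.Agent, p.SharePRBox s t := by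
  have hbad : ∀ j : S.Agent, ∃ i, i ≠ j ∧ (i ∉ S.friends ∨ S.numSettings i ≠ 2) := by
    intro j
    by_contra hcon
    refine h ⟨j, fun i hi => ?_⟩
    by_contra hi'
    exact hcon ⟨i, hi, not_and_or.1 hi'⟩
  -- The agent 0 is an arbitrary choice to obtain `s`; applying `hbad` to `s` then yields a second
  -- such agent.
  obtain ⟨s, -, hs⟩ := hbad ⟨0, lt_of_lt_of_le Nat.zero_lt_two S.two_le_numAgents⟩
  obtain ⟨t, hts, ht⟩ := hbad s
  obtain ⟨p, hp, hst⟩ := exists_sharePRBox hts.symm hs ht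
  exact ⟨p, hp, hst.notMem_B, s, t, hst⟩

end LFScenario

theorem mainTheorem2 (S : LFScenario) :
    (S.LF = S.B ↔
      (S.friends.card + 1 = S.numAgents ∧ ∀ j ∈ S.friends, S.numSettings j = 2) ∨
      (S.friends = Finset.univ ∧
        S.numAgents ≤ (Finset.univ.filter fun i => S.numSettings i = 2).card + 1)) ∧
    (¬ ((S.friends.card + 1 = S.numAgents ∧ ∀ j ∈ S.friends, S.numSettings j = 2) ∨
        (S.friends = Finset.univ ∧
          S.numAgents ≤ (Finset.univ.filter fun i => S.numSettings i = 2).card + 1)) →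
      ∃ p ∈ S.LF, p ∉ S.B ∧ ∃ s t : S.Agent, p.SharePRBox s t) := by
  rw [S.exists_agent_iff]
  refine ⟨⟨fun h => ?_, fun ⟨j, hj⟩ => (S.LF_subset_B hj).antisymm S.B_subset_LF⟩,
    S.exists_mem_LF_sharePRBox⟩
  by_contra hcon
  obtain ⟨p, hp, hpB, -⟩ := S.exists_mem_LF_sharePRBox hcon
  exact hpB (h ▸ hp)
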